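/- Let $\mathbb{D}$ be the open unit disk in $\mathbb{C}$, let $H(\mathbb{D})$ be the space of analytic functions on $\mathbb{D}$, and let $dA$ be the area measure on $\mathbb{D}$ normalized so that $A(\mathbb{D})=1$. For $w\in\mathbb{D}$ put $k_w(z)=\dfrac{1}{(1-\overline{w}z)^2}$ and $\|k_w\|_{A^1}=\int_{\mathbb{D}}|k_w(z)|\,dA(z)$. Let $X$ be the normed space of all $f\in H(\mathbb{D})$ with $$\|f\|_X=\sup_{z\in\mathbb{D}}|f(z)|\,\|k_z\|_{A^1}^{-1}<\infty ,$$ and let the Bloch space $\mathcal{B}$ be the set of all $f\in H(\mathbb{D})$ with $\sup_{z\in\mathbb{D}}(1-|z|^2)|f'(z)|<\infty$. Theorem. The Bloch space is not dense in $X$; that is, $\mathcal{B}\cap X$ is not a dense subset of $X$ for the norm $\|\cdot\|_X$. (It is known that $\mathcal{B}\subset X$.) -/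

import Mathlib

open MeasureTheory Metric
open scoped ComplexConjugate Complex.UnitDisc

noncomputable section

namespace BlochX

/-- Extension by zero of a function on the open unit disc to the plane. It is only ever
evaluated or differentiated at points of the (open) disc. -/
def extendZero (f : 𝔻 → ℂ) : ℂ → ℂ := Function.extend ((↑) : 𝔻 → ℂ) f 0

theorem extendZero_coe (f : 𝔻 → ℂ) (z : 𝔻) : extendZero f (z : ℂ) = f z :=
  Complex.UnitDisc.coe_injective.extend_apply f 0 z

theorem extendZero_add (f g : 𝔻 → ℂ) : extendZero (f + g) = extendZero f + extendZero g := by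
  have h := Function.extend_add ((↑) : 𝔻 → ℂ) f g (0 : ℂ → ℂ) 0
  rw [add_zero] at h
  exact h

theorem extendZero_smul (c : ℂ) (f : 𝔻 → ℂ) : extendZero (c • f) = c • extendZero f := by
  have h := Function.extend_smul c ((↑) : 𝔻 → ℂ) f (0 : ℂ → ℂ)
  rw [smul_zero] at h
  exact h

theorem extendZero_zero : extendZero 0 = 0 := Function.extend_zero _

/-- The analytic functions on the open unit disc, as a subspace of all functions on the disc. -/
def analyticSubmodule : Submodule ℂ (𝔻 → ℂ) where
  carrier := {f | DifferentiableOn ℂ (extendZero f) (ball (0 : ℂ) 1)}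
  add_mem' {f g} hf hg := by
    simp only [Set.mem_ofPred_eq] at hf hg ⊢
    rw [extendZero_add]
    exact hf.add hg
  zero_mem' := by
    simp only [Set.mem_ofPred_eq]
    rw [extendZero_zero]
    exact differentiableOn_const 0
  smul_mem' c f hf := by
    simp only [Set.mem_ofPred_eq] at hf ⊢
    rw [extendZero_smul]
    exact hf.const_smul c

/-- `H(𝔻)`, the vector space of analytic functions on the open unit disc. It is a separate type
so that it does not inherit the topology of pointwise convergence. -/
def HolDisc : Type := analyticSubmodule

instance : AddCommGroup HolDisc := inferInstanceAs (AddCommGroup analyticSubmodule)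

instance : Module ℂ HolDisc := inferInstanceAs (Module ℂ analyticSubmodule)

namespace HolDisc

instance : CoeFun HolDisc (fun _ => 𝔻 → ℂ) := ⟨Subtype.val⟩

theorem ext {f g : HolDisc} (h : ∀ z, f z = g z) : f = g := Subtype.ext (funext h)

theorem differentiableOn (f : HolDisc) : DifferentiableOn ℂ (extendZero f) (ball (0 : ℂ) 1) := f.2

theorem add_apply (f g : HolDisc) (z : 𝔻) : (f + g) z = f z + g z := rfl

theorem smul_apply (c : ℂ) (f : HolDisc) (z : 𝔻) : (c • f) z = c * f z := rfl

theorem zero_apply (z : 𝔻) : (0 : HolDisc) z = 0 := rfl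

/-- The complex derivative `f'(z)` at a point of the disc. -/
def derivAt (f : HolDisc) (z : 𝔻) : ℂ := deriv (extendZero f) (z : ℂ)

theorem differentiableAt (f : HolDisc) (z : 𝔻) : DifferentiableAt ℂ (extendZero f) (z : ℂ) :=
  f.differentiableOn.differentiableAt
    (isOpen_ball.mem_nhds (mem_ball_zero_iff.2 z.norm_lt_one))

theorem derivAt_add (f g : HolDisc) (z : 𝔻) : (f + g).derivAt z = f.derivAt z + g.derivAt z := by
  have h : extendZero (f + g : HolDisc) = extendZero f + extendZero g := extendZero_add f g
  rw [derivAt, h]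
  exact deriv_add (f.differentiableAt z) (g.differentiableAt z)

theorem derivAt_smul (c : ℂ) (f : HolDisc) (z : 𝔻) : (c • f).derivAt z = c * f.derivAt z := by
  have h : extendZero (c • f : HolDisc) = c • extendZero f := extendZero_smul c f
  rw [derivAt, h]
  exact deriv_const_smul c (f.differentiableAt z)

theorem derivAt_zero (z : 𝔻) : (0 : HolDisc).derivAt z = 0 := by
  have h : extendZero (0 : HolDisc) = 0 := extendZero_zero
  rw [derivAt, h]
  exact deriv_const _ _

end HolDisc

/-- The Bloch space: analytic `f` with `sup_z (1 - |z|²) |f'(z)| < ∞`. -/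
def Bloch : Submodule ℂ HolDisc where
  carrier := {f | BddAbove (Set.range fun z : 𝔻 => (1 - ‖(z : ℂ)‖ ^ 2) * ‖f.derivAt z‖)}
  add_mem' {f g} hf hg := by
    obtain ⟨A, hA⟩ := hf
    obtain ⟨B, hB⟩ := hg
    refine ⟨A + B, ?_⟩
    rintro _ ⟨z, rfl⟩
    have h1 := hA ⟨z, rfl⟩
    have h2 := hB ⟨z, rfl⟩
    have h3 : 0 ≤ 1 - ‖(z : ℂ)‖ ^ 2 := by linarith [z.sq_norm_lt_one]
    have h4 := mul_le_mul_of_nonneg_left (norm_add_le (f.derivAt z) (g.derivAt z)) h3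
    simp only [HolDisc.derivAt_add] at *
    linarith
  zero_mem' := by
    refine ⟨0, ?_⟩
    rintro _ ⟨z, rfl⟩
    simp [HolDisc.derivAt_zero]
  smul_mem' c f hf := by
    obtain ⟨A, hA⟩ := hf
    refine ⟨‖c‖ * A, ?_⟩
    rintro _ ⟨z, rfl⟩
    have h1 := mul_le_mul_of_nonneg_left (hA ⟨z, rfl⟩) (norm_nonneg c)
    simp only [HolDisc.derivAt_smul, norm_mul] at *
    linarith

/-- The normalized area measure `dA` of the open unit disc. -/
def areaMeasure : Measure ℂ :=
  ENNReal.ofReal Real.pi⁻¹ • (volume : Measure ℂ).restrict (ball (0 : ℂ) 1)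

/-- The Bergman norm `‖g‖_{A¹} = ∫_𝔻 |g| dA`. -/
def normA1 (g : ℂ → ℂ) : ℝ := ∫ z, ‖g z‖ ∂areaMeasure

/-- The reproducing kernel `k_w(z) = 1 / (1 - w̄ z)²` of the Bergman space `A²`. -/
def kernel (w : 𝔻) (z : ℂ) : ℂ := 1 / (1 - conj (w : ℂ) * z) ^ 2

theorem one_sub_ne_zero (w : 𝔻) {z : ℂ} (hz : z ∈ closedBall (0 : ℂ) 1) :
    1 - conj (w : ℂ) * z ≠ 0 := by
  intro h
  have h1 : ‖conj (w : ℂ) * z‖ = 1 := by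
    rw [← sub_eq_zero.1 h, norm_one]
  rw [norm_mul, Complex.norm_conj] at h1
  have h2 := w.norm_lt_one
  have h3 : ‖z‖ ≤ 1 := mem_closedBall_zero_iff.1 hz
  have h4 := norm_nonneg (w : ℂ)
  nlinarith [norm_nonneg z]

theorem integrable_kernel (w : 𝔻) : Integrable (fun z => ‖kernel w z‖) areaMeasure := by
  refine Integrable.smul_measure ?_ ENNReal.ofReal_ne_top
  have h : ContinuousOn (fun z => ‖kernel w z‖) (closedBall (0 : ℂ) 1) := by
    refine ContinuousOn.norm (ContinuousOn.div continuousOn_const (by fun_prop) ?_)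
    intro z hz
    exact pow_ne_zero 2 (one_sub_ne_zero w hz)
  exact (h.integrableOn_compact (isCompact_closedBall 0 1)).mono_set ball_subset_closedBall

theorem normA1_kernel_pos (w : 𝔻) : 0 < normA1 (kernel w) := by
  rw [normA1, integral_pos_iff_support_of_nonneg (fun z => norm_nonneg _) (integrable_kernel w)]
  have hsub : ball (0 : ℂ) 1 ⊆ Function.support fun z => ‖kernel w z‖ := by
    intro z hz
    rw [Function.mem_support, norm_ne_zero_iff, kernel]
    exact div_ne_zero one_ne_zero
      (pow_ne_zero 2 (one_sub_ne_zero w (ball_subset_closedBall hz)))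
  refine lt_of_lt_of_le ?_ (measure_mono hsub)
  rw [areaMeasure, Measure.smul_apply, Measure.restrict_apply_self, smul_eq_mul]
  refine ENNReal.mul_pos ?_ ?_
  · exact (ENNReal.ofReal_pos.2 (inv_pos.2 Real.pi_pos)).ne'
  · exact (measure_ball_pos volume (0 : ℂ) one_pos).ne'

/-- The space `X`: analytic `f` with `sup_z |f(z)| ‖k_z‖_{A¹}⁻¹ < ∞`. -/
def X : Submodule ℂ HolDisc where
  carrier := {f | BddAbove (Set.range fun z : 𝔻 => ‖f z‖ * (normA1 (kernel z))⁻¹)}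
  add_mem' {f g} hf hg := by
    obtain ⟨A, hA⟩ := hf
    obtain ⟨B, hB⟩ := hg
    refine ⟨A + B, ?_⟩
    rintro _ ⟨z, rfl⟩
    have h1 := hA ⟨z, rfl⟩
    have h2 := hB ⟨z, rfl⟩
    have h4 := mul_le_mul_of_nonneg_right (norm_add_le (f z) (g z))
      (inv_pos.2 (normA1_kernel_pos z)).le
    simp only [HolDisc.add_apply] at *
    linarith
  zero_mem' := by
    refine ⟨0, ?_⟩
    rintro _ ⟨z, rfl⟩
    simp [HolDisc.zero_apply]
  smul_mem' c f hf := by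
    obtain ⟨A, hA⟩ := hf
    refine ⟨‖c‖ * A, ?_⟩
    rintro _ ⟨z, rfl⟩
    have h1 := mul_le_mul_of_nonneg_left (hA ⟨z, rfl⟩) (norm_nonneg c)
    simp only [HolDisc.smul_apply, norm_mul] at *
    linarith

/-- The norm `‖f‖_X = sup_z |f(z)| ‖k_z‖_{A¹}⁻¹`. -/
instance : Norm X := ⟨fun f => ⨆ z : 𝔻, ‖f.1 z‖ * (normA1 (kernel z))⁻¹⟩

theorem X.norm_def (f : X) : ‖f‖ = ⨆ z : 𝔻, ‖f.1 z‖ * (normA1 (kernel z))⁻¹ := rfl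

theorem X.le_norm (f : X) (z : 𝔻) : ‖f.1 z‖ * (normA1 (kernel z))⁻¹ ≤ ‖f‖ := le_ciSup f.2 z

theorem X.core : NormedSpace.Core ℂ X where
  norm_nonneg f := Real.iSup_nonneg fun z =>
    mul_nonneg (norm_nonneg _) (inv_pos.2 (normA1_kernel_pos z)).le
  norm_smul c f := by
    rw [X.norm_def, X.norm_def, Real.mul_iSup_of_nonneg (norm_nonneg c)]
    congr 1
    funext z
    rw [← mul_assoc, ← norm_mul]
    rfl
  norm_triangle f g := by
    refine ciSup_le fun z => ?_
    have h4 := mul_le_mul_of_nonneg_right (norm_add_le (f.1 z) (g.1 z))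
      (inv_pos.2 (normA1_kernel_pos z)).le
    rw [add_mul] at h4
    exact h4.trans (add_le_add (X.le_norm f z) (X.le_norm g z))
  norm_eq_zero_iff f := by
    constructor
    · intro h
      refine Subtype.ext (HolDisc.ext fun z => ?_)
      have h1 := X.le_norm f z
      rw [h] at h1
      have h2 := inv_pos.2 (normA1_kernel_pos z)
      have h3 : ‖f.1 z‖ ≤ 0 := by
        by_contra hc
        exact absurd h1 (not_le.2 (mul_pos (not_le.1 hc) h2))
      exact norm_le_zero_iff.1 h3
    · rintro rfl
      have h : ∀ z : 𝔻, ‖(0 : X).1 z‖ * (normA1 (kernel z))⁻¹ = 0 := fun z => by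
        have h0 : (0 : X).1 z = 0 := rfl
        rw [h0, norm_zero, zero_mul]
      rw [X.norm_def]
      simp only [h, Real.iSup_const_zero]

/-- `X` with the topology of the norm `‖·‖_X`. -/
instance : NormedAddCommGroup X := NormedAddCommGroup.ofCore X.core

instance : NormedSpace ℂ X := NormedSpace.ofCore X.core

end BlochX

end

/-!
The Taylor coefficients at the origin separate the Bloch space from a lacunary series. By Cauchy's
estimates on the circle `|z|² = n / (n + 1)`, the coefficients of a Bloch function are bounded,
while the `n`-th coefficient of `f ∈ X` is at most `6 ‖f‖ log (n + 1)`, because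
`|w|² ‖k_w‖ = -log (1 - |w|²)`. Hence the coefficients of any `f` in the closure of the Bloch space
are `o(log n)`. The series `∑ 2ᵏ z ^ Nₖ` with `log Nₖ ≍ 2ᵏ` violates this, and it lies in `X`:
condensing the series `-log (1 - |z|²) = ∑ |z|²ⁿ / n` twice gives `∑ 2ᵏ |z| ^ Nₖ ≤ 2 ‖k_z‖`.
-/

namespace BlochX

open Filter Asymptotics Set
open scoped Nat Topology

theorem integral_Ioo_comp_circleMap {E : Type*} [NormedAddCommGroup E] [NormedSpace ℝ E]
    (f : ℂ → E) (c : ℂ) (r : ℝ) :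
    ∫ θ in Ioo (-Real.pi) Real.pi, f (circleMap c r θ) =
      (2 * Real.pi) • Real.circleAverage f c r := by
  rw [Real.circleAverage_eq_integral_add (-Real.pi),
    intervalIntegral.integral_comp_add_right (fun θ => f (circleMap c r θ)),
    smul_inv_smul₀ Real.two_pi_pos.ne', zero_add, show 2 * Real.pi + -Real.pi = Real.pi by ring,
    intervalIntegral.integral_of_le (by linarith [Real.pi_pos]), integral_Ioc_eq_integral_Ioo]

theorem setIntegral_ball_eq_integral_circleAverage {E : Type*} [NormedAddCommGroup E]
    [NormedSpace ℝ E] {f : ℂ → E} {R : ℝ} (hR : 0 ≤ R)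
    (hf : ContinuousOn f (closedBall (0 : ℂ) R)) :
    ∫ z in ball (0 : ℂ) R, f z =
      (2 * Real.pi) • ∫ r in (0 : ℝ)..R, r • Real.circleAverage f 0 r := by
  set F : ℝ × ℝ → E := fun p => p.1 • f (circleMap 0 p.1 p.2) with hF
  set S : Set (ℝ × ℝ) := Ioo (0 : ℝ) R ×ˢ Ioo (-Real.pi) Real.pi with hS
  have hcirc (p : ℝ × ℝ) : Complex.polarCoord.symm p = circleMap 0 p.1 p.2 := by
    rw [Complex.polarCoord_symm_apply, circleMap_zero, Complex.exp_mul_I,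
      Complex.ofReal_cos, Complex.ofReal_sin]
  have hint : IntegrableOn F S (volume.prod volume) := by
    have hcont : ContinuousOn F (Icc (0 : ℝ) R ×ˢ Icc (-Real.pi) Real.pi) := by
      refine continuousOn_fst.smul (hf.comp (by unfold circleMap; fun_prop) ?_)
      rintro ⟨r, θ⟩ ⟨hr, -⟩
      simpa [abs_of_nonneg hr.1] using hr.2
    exact (hcont.integrableOn_compact (isCompact_Icc.prod isCompact_Icc)).mono_set
      (prod_mono Ioo_subset_Icc_self Ioo_subset_Icc_self)
  have hind : ∀ p ∈ polarCoord.target,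
      p.1 • (ball (0 : ℂ) R).indicator f (Complex.polarCoord.symm p) = S.indicator F p := by
    rintro ⟨r, θ⟩ ⟨hr, hθ⟩
    have hmem : circleMap 0 r θ ∈ ball (0 : ℂ) R ↔ (r, θ) ∈ S := by
      simp [hS, abs_of_pos (mem_Ioi.1 hr), mem_Ioi.1 hr, hθ.1, hθ.2]
    simp only [hcirc, indicator, hmem, smul_ite, smul_zero, hF]
  calc ∫ z in ball (0 : ℂ) R, f z
      = ∫ p in polarCoord.target, S.indicator F p := by
        rw [← integral_indicator measurableSet_ball, ← Complex.integral_comp_polarCoord_symm,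
          setIntegral_congr_fun polarCoord.open_target.measurableSet hind]
    _ = ∫ p in S, F p := by
        rw [setIntegral_indicator (measurableSet_Ioo.prod measurableSet_Ioo), inter_eq_right.2]
        exact prod_mono (fun r hr => hr.1) subset_rfl
    _ = ∫ r in Ioo 0 R, ∫ θ in Ioo (-Real.pi) Real.pi, F (r, θ) := by
        rw [Measure.volume_eq_prod, setIntegral_prod _ hint]
    _ = (2 * Real.pi) • ∫ r in (0 : ℝ)..R, r • Real.circleAverage f 0 r := by
        simp only [hF, integral_smul, integral_Ioo_comp_circleMap, smul_comm _ (2 * Real.pi)]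
        rw [intervalIntegral.integral_of_le hR, integral_Ioc_eq_integral_Ioo]

theorem circleAverage_poissonKernel {c w : ℂ} {R : ℝ} (hw : w ∈ ball c R) :
    Real.circleAverage (poissonKernel c w) c R = 1 := by
  have h := (InnerProductSpace.harmonicOnNhd_const
    (s := closedBall c R) (1 : ℝ)).circleAverage_poissonKernel_smul hw
  rwa [smul_eq_mul, ← Pi.one_def, mul_one] at h

theorem norm_sub_norm_sq_mul (w z : ℂ) : ‖z - ‖z‖ ^ 2 * w‖ = ‖z‖ * ‖1 - conj w * z‖ := by
  rw [← Complex.mul_conj', ← Complex.norm_conj (1 - _), ← norm_mul]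
  simp only [map_sub, map_one, map_mul, Complex.conj_conj]
  ring_nf

theorem norm_sq_mul_norm_sq_lt_one (w : 𝔻) {z : ℂ} (hz : z ∈ closedBall (0 : ℂ) 1) :
    ‖(w : ℂ)‖ ^ 2 * ‖z‖ ^ 2 < 1 :=
  mul_lt_one_of_nonneg_of_lt_one_left (sq_nonneg _) w.sq_norm_lt_one
    (pow_le_one₀ (norm_nonneg z) (mem_closedBall_zero_iff.1 hz))

theorem norm_kernel_eq_poissonKernel (w : 𝔻) {z : ℂ} (hz : z ∈ closedBall (0 : ℂ) 1)
    (hz0 : z ≠ 0) :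
    ‖kernel w z‖ =
      (1 - ‖(w : ℂ)‖ ^ 2 * ‖z‖ ^ 2)⁻¹ * poissonKernel 0 (‖z‖ ^ 2 * w) z := by
  have hw : 1 - ‖(w : ℂ)‖ ^ 2 * ‖z‖ ^ 2 ≠ 0 := (sub_pos.2 (norm_sq_mul_norm_sq_lt_one w hz)).ne'
  have hden : ‖1 - conj (w : ℂ) * z‖ ≠ 0 := norm_ne_zero_iff.2 (one_sub_ne_zero w hz)
  rw [poissonKernel_def, sub_zero, sub_zero, norm_sub_norm_sq_mul, kernel, norm_mul, norm_pow,
    norm_div, norm_pow, norm_one, Complex.norm_real, norm_norm]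
  field_simp

theorem circleAverage_norm_kernel (w : 𝔻) {r : ℝ} (hr : r ∈ Icc (0 : ℝ) 1) :
    Real.circleAverage (fun z => ‖kernel w z‖) 0 r = (1 - ‖(w : ℂ)‖ ^ 2 * r ^ 2)⁻¹ := by
  rcases hr.1.eq_or_lt with rfl | hr0
  · simp [kernel]
  have hball : (r ^ 2 * w : ℂ) ∈ ball (0 : ℂ) r := by
    have h := mul_lt_one_of_nonneg_of_lt_one_right hr.2 (norm_nonneg (w : ℂ)) w.norm_lt_one
    rw [mem_ball_zero_iff, norm_mul, norm_pow, Complex.norm_real, Real.norm_of_nonneg hr.1, sq,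
      mul_assoc]
    exact mul_lt_of_lt_one_right hr0 h
  have heq : EqOn (fun z => ‖kernel w z‖)
      (fun z => (1 - ‖(w : ℂ)‖ ^ 2 * r ^ 2)⁻¹ • poissonKernel 0 (r ^ 2 * w) z)
      (sphere 0 |r|) := fun z hz => by
    have hzr : ‖z‖ = r := by rw [mem_sphere_zero_iff_norm.1 hz, abs_of_pos hr0]
    have h := norm_kernel_eq_poissonKernel w (mem_closedBall_zero_iff.2 (hzr.trans_le hr.2))
      (norm_pos_iff.1 (hr0.trans_eq hzr.symm))
    rwa [hzr] at h
  rw [Real.circleAverage_congr_sphere heq, Real.circleAverage_fun_smul,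
    circleAverage_poissonKernel hball, smul_eq_mul, mul_one]

theorem normA1_eq_integral_circleAverage {g : ℂ → ℂ} (hg : ContinuousOn g (closedBall (0 : ℂ) 1)) :
    normA1 g = ∫ r in (0 : ℝ)..1, 2 * r * Real.circleAverage (fun z => ‖g z‖) 0 r := by
  rw [normA1, areaMeasure, integral_smul_measure,
    setIntegral_ball_eq_integral_circleAverage zero_le_one hg.norm,
    ENNReal.toReal_ofReal (inv_pos.2 Real.pi_pos).le, smul_smul,
    ← intervalIntegral.integral_smul]
  simp only [smul_eq_mul]
  field_simp [Real.pi_ne_zero]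

theorem continuousOn_kernel (w : 𝔻) : ContinuousOn (kernel w) (closedBall (0 : ℂ) 1) :=
  continuousOn_const.div (by fun_prop) fun _ hz => pow_ne_zero 2 (one_sub_ne_zero w hz)

theorem norm_sq_mul_normA1_kernel (w : 𝔻) :
    ‖(w : ℂ)‖ ^ 2 * normA1 (kernel w) = -Real.log (1 - ‖(w : ℂ)‖ ^ 2) := by
  set t := ‖(w : ℂ)‖ ^ 2 with ht
  have hne : ∀ r ∈ uIcc (0 : ℝ) 1, 1 - t * r ^ 2 ≠ 0 := fun r hr => by
    rw [uIcc_of_le zero_le_one] at hr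
    have hlt : t * r ^ 2 < 1 := mul_lt_one_of_nonneg_of_lt_one_left (sq_nonneg _)
      w.sq_norm_lt_one (pow_le_one₀ hr.1 hr.2)
    exact (sub_pos.2 hlt).ne'
  have hderiv : ∀ r ∈ uIcc (0 : ℝ) 1, HasDerivAt (fun r => -Real.log (1 - t * r ^ 2))
      (t * (2 * r * (1 - t * r ^ 2)⁻¹)) r := fun r hr => by
    convert! ((((hasDerivAt_pow 2 r).const_mul t).const_sub 1).log (hne r hr)).neg using 1
    ring
  have hcont : ContinuousOn (fun r => t * (2 * r * (1 - t * r ^ 2)⁻¹)) (uIcc (0 : ℝ) 1) := by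
    fun_prop (disch := assumption)
  calc t * normA1 (kernel w) = ∫ r in (0 : ℝ)..1, t * (2 * r * (1 - t * r ^ 2)⁻¹) := by
        rw [normA1_eq_integral_circleAverage (continuousOn_kernel w),
          intervalIntegral.integral_const_mul]
        congr 1
        refine intervalIntegral.integral_congr fun r hr => ?_
        rw [uIcc_of_le zero_le_one] at hr
        simp only [circleAverage_norm_kernel w hr, ht]
    _ = -Real.log (1 - t) := by
        rw [intervalIntegral.integral_eq_sub_of_hasDerivAt hderiv hcont.intervalIntegrable]
        simp

theorem sum_two_pow_mul_condensed_le {f : ℕ → ℝ} (hf : ∀ ⦃m n⦄, 1 < m → m ≤ n → f n ≤ f m)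
    (hf1 : 0 ≤ f 1) (K : ℕ) :
    ∑ k ∈ Finset.range K, 2 ^ k * f (2 ^ (k + 1)) ≤ ∑ n ∈ Finset.range (2 ^ K), f (n + 1) := by
  have h := Finset.sum_condensed_le' hf K
  simp only [nsmul_eq_mul, Nat.cast_pow, Nat.cast_ofNat] at h
  rw [Finset.range_eq_Ico (a := 2 ^ K), Finset.sum_Ico_add' f 0 (2 ^ K) 1, zero_add,
    Finset.sum_eq_sum_Ico_succ_bot (by simp)]
  linarith

theorem sum_two_pow_mul_pow_le_neg_log {t : ℝ} (ht0 : 0 ≤ t) (ht1 : t < 1) (K : ℕ) :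
    ∑ k ∈ Finset.range K, 2 ^ k * t ^ 2 ^ 2 ^ (k + 1) ≤ -2 * Real.log (1 - t) := by
  have hanti {m n : ℕ} (h : m ≤ n) : t ^ n ≤ t ^ m := pow_le_pow_of_le_one ht0 ht1.le h
  calc ∑ k ∈ Finset.range K, 2 ^ k * t ^ 2 ^ 2 ^ (k + 1)
      ≤ ∑ m ∈ Finset.range (2 ^ K), t ^ 2 ^ (m + 1) :=
        sum_two_pow_mul_condensed_le (f := fun m => t ^ 2 ^ m)
          (fun m n _ h => hanti (Nat.pow_le_pow_right two_pos h)) (by positivity) K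
    _ = 2 * ∑ m ∈ Finset.range (2 ^ K), 2 ^ m * (t ^ 2 ^ (m + 1) / (2 ^ (m + 1) : ℕ)) := by
        rw [Finset.mul_sum]
        refine Finset.sum_congr rfl fun m _ => ?_
        push_cast
        rw [pow_succ (2 : ℝ) m]
        field_simp
    _ ≤ 2 * ∑ n ∈ Finset.range (2 ^ 2 ^ K), t ^ (n + 1) / (n + 1 : ℕ) := by
        gcongr
        refine sum_two_pow_mul_condensed_le (f := fun n => t ^ n / n) (fun m n hm h => ?_)
          (by positivity) _
        have : (0 : ℝ) < m := by positivity
        have := hanti h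
        gcongr
    _ ≤ 2 * -Real.log (1 - t) := by
        gcongr
        have hlog := Real.hasSum_pow_div_log_of_abs_lt_one ((abs_of_nonneg ht0).trans_lt ht1)
        exact_mod_cast sum_le_hasSum _ (fun n _ => by positivity) hlog
    _ = -2 * Real.log (1 - t) := by ring

/-- The exponents `Nₖ` of the lacunary series, with `log Nₖ ≍ 2ᵏ`. The leading factor `2` makes
`|z| ^ Nₖ` a power of `|z|²`, the variable of the logarithm in `norm_sq_mul_normA1_kernel`. -/
def lacunaryExponent (k : ℕ) : ℕ := 2 * 2 ^ 2 ^ (k + 1)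

theorem lacunaryExponent_strictMono : StrictMono lacunaryExponent := fun a b h => by
  unfold lacunaryExponent
  gcongr <;> norm_num

theorem sum_two_pow_mul_norm_pow_le (z : 𝔻) (K : ℕ) :
    ∑ k ∈ Finset.range K, 2 ^ k * ‖(z : ℂ)‖ ^ lacunaryExponent k ≤ 2 * normA1 (kernel z) := by
  simp only [lacunaryExponent, pow_mul]
  calc ∑ k ∈ Finset.range K, 2 ^ k * (‖(z : ℂ)‖ ^ 2) ^ 2 ^ 2 ^ (k + 1)
      ≤ -2 * Real.log (1 - ‖(z : ℂ)‖ ^ 2) :=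
        sum_two_pow_mul_pow_le_neg_log (sq_nonneg _) z.sq_norm_lt_one K
    _ = ‖(z : ℂ)‖ ^ 2 * (2 * normA1 (kernel z)) := by
        linarith [norm_sq_mul_normA1_kernel z]
    _ ≤ 2 * normA1 (kernel z) :=
      mul_le_of_le_one_left (by linarith [normA1_kernel_pos z]) z.sq_norm_lt_one.le

/-- The lacunary series `∑ 2ᵏ z ^ Nₖ`, which witnesses that the Bloch space is not dense. -/
noncomputable def lacunary (z : 𝔻) : ℂ := ∑' k, 2 ^ k * (z : ℂ) ^ lacunaryExponent k

theorem summable_norm_two_pow_mul_pow_lacunaryExponent (z : 𝔻) :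
    Summable fun k => ‖(2 ^ k * (z : ℂ) ^ lacunaryExponent k : ℂ)‖ := by
  simp only [norm_mul, norm_pow, Complex.norm_two]
  exact summable_of_sum_range_le (fun k => by positivity) (sum_two_pow_mul_norm_pow_le z)

theorem norm_lacunary_le (z : 𝔻) : ‖lacunary z‖ ≤ 2 * normA1 (kernel z) := by
  refine (norm_tsum_le_tsum_norm (summable_norm_two_pow_mul_pow_lacunaryExponent z)).trans ?_
  simp only [norm_mul, norm_pow, Complex.norm_two]
  exact Real.tsum_le_of_sum_range_le (fun k => by positivity) (sum_two_pow_mul_norm_pow_le z)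

/-- The coefficient sequence of `lacunary` as a full power series: `2ᵏ` at `Nₖ` and `0` at all
other indices. -/
noncomputable def lacunaryCoeff : ℕ → ℂ := Function.extend lacunaryExponent (2 ^ ·) 0

theorem lacunaryCoeff_lacunaryExponent (k : ℕ) : lacunaryCoeff (lacunaryExponent k) = 2 ^ k :=
  lacunaryExponent_strictMono.injective.extend_apply _ _ k

theorem hasSum_lacunaryCoeff (z : 𝔻) :
    HasSum (fun n => lacunaryCoeff n * (z : ℂ) ^ n) (lacunary z) := by
  refine (lacunaryExponent_strictMono.injective.hasSum_iff fun n hn => ?_).1 ?_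
  · rw [lacunaryCoeff, Function.extend_apply' _ _ _ hn, Pi.zero_apply, zero_mul]
  · simp only [Function.comp_def, lacunaryCoeff_lacunaryExponent]
    exact (summable_norm_two_pow_mul_pow_lacunaryExponent z).of_norm.hasSum

theorem eball_one_eq_ball {α : Type*} [PseudoMetricSpace α] (x : α) : eball x 1 = ball x 1 := by
  rw [← ENNReal.ofReal_one, eball_ofReal]

theorem hasFPowerSeriesOnBall_extendZero {f : 𝔻 → ℂ} {c : ℕ → ℂ}
    (h : ∀ z : 𝔻, HasSum (fun n => c n * (z : ℂ) ^ n) (f z)) :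
    HasFPowerSeriesOnBall (extendZero f) (FormalMultilinearSeries.ofScalars ℂ c) 0 1 where
  r_le := by
    refine ENNReal.le_of_forall_nnreal_lt fun r hr => ?_
    have hr1 : ‖(r : ℂ)‖ < 1 := by
      simpa using hr
    refine FormalMultilinearSeries.le_radius_of_tendsto _ (l := 0) ?_
    simpa using (h (Complex.UnitDisc.mk r hr1)).summable.tendsto_atTop_zero.norm
  r_pos := one_pos
  hasSum {z} hz := by
    have hz1 : ‖z‖ < 1 := by rwa [eball_one_eq_ball, mem_ball_zero_iff] at hz
    have hsum := h (Complex.UnitDisc.mk z hz1)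
    rw [← extendZero_coe f] at hsum
    simpa [mul_comm] using hsum

theorem differentiableOn_extendZero_of_hasSum {f : 𝔻 → ℂ} {c : ℕ → ℂ}
    (h : ∀ z : 𝔻, HasSum (fun n => c n * (z : ℂ) ^ n) (f z)) :
    DifferentiableOn ℂ (extendZero f) (ball (0 : ℂ) 1) :=
  eball_one_eq_ball (0 : ℂ) ▸ (hasFPowerSeriesOnBall_extendZero h).differentiableOn

namespace HolDisc

theorem contDiffAt_zero (n : ℕ) (f : HolDisc) : ContDiffAt ℂ n (extendZero f) 0 :=
  (f.differentiableOn.contDiffOn isOpen_ball).contDiffAt (ball_mem_nhds 0 one_pos)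

/-- The `n`-th Taylor coefficient at the origin, as a linear functional. The derivatives are those
of the extension by zero, which agrees with `f` near the origin. -/
noncomputable def taylorCoeff (n : ℕ) : HolDisc →ₗ[ℂ] ℂ where
  toFun f := iteratedDeriv n (extendZero f) 0 / (n ! : ℂ)
  map_add' f g := by
    have h : extendZero (f + g : HolDisc) = extendZero f + extendZero g := extendZero_add f g
    rw [h, iteratedDeriv_add (contDiffAt_zero n f) (contDiffAt_zero n g), add_div]
  map_smul' c f := by
    have h : extendZero (c • f : HolDisc) = c • extendZero f := extendZero_smul c f
    rw [h, iteratedDeriv_const_smul_field]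
    simp [mul_div_assoc]

theorem taylorCoeff_apply (n : ℕ) (f : HolDisc) :
    taylorCoeff n f = iteratedDeriv n (extendZero f) 0 / n ! := rfl

theorem taylorCoeff_eq {f : HolDisc} {c : ℕ → ℂ}
    (h : ∀ z : 𝔻, HasSum (fun n => c n * (z : ℂ) ^ n) (f z)) (n : ℕ) : taylorCoeff n f = c n := by
  have hf := (hasFPowerSeriesOnBall_extendZero h).hasFPowerSeriesAt
  have heq := hf.analyticAt.hasFPowerSeriesAt.eq_formalMultilinearSeries hf
  exact congrFun (FormalMultilinearSeries.ofScalars_series_injective ℂ ℂ heq) n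

end HolDisc

/-- The lacunary series as an element of `X`. -/
noncomputable def lacunaryX : X where
  val := ⟨lacunary, differentiableOn_extendZero_of_hasSum hasSum_lacunaryCoeff⟩
  property := ⟨2, forall_mem_range.2 fun z =>
    (mul_inv_le_iff₀ (normA1_kernel_pos z)).2 (norm_lacunary_le z)⟩

theorem norm_le_norm_mul_normA1_kernel (f : X) (z : 𝔻) : ‖f.1 z‖ ≤ ‖f‖ * normA1 (kernel z) :=
  (mul_inv_le_iff₀ (normA1_kernel_pos z)).1 (X.le_norm f z)

theorem norm_iteratedDeriv_le_of_forall_norm_eq {E : Type*} [NormedAddCommGroup E]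
    [NormedSpace ℂ E] [CompleteSpace E] {g : ℂ → E} (hg : DifferentiableOn ℂ g (ball 0 1))
    {r C : ℝ} (hr : r ∈ Ioo (0 : ℝ) 1) (hC : ∀ z : 𝔻, ‖(z : ℂ)‖ = r → ‖g z‖ ≤ C) (n : ℕ) :
    ‖iteratedDeriv n g 0‖ ≤ n ! * C / r ^ n := by
  refine Complex.norm_iteratedDeriv_le_of_forall_mem_sphere_norm_le n hr.1
    (hg.diffContOnCl_ball (closedBall_subset_ball hr.2)) fun z hz => ?_
  rw [mem_sphere_zero_iff_norm] at hz
  exact hC (Complex.UnitDisc.mk z (hz.trans_lt hr.2)) hz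

namespace HolDisc

theorem norm_taylorCoeff_le (f : HolDisc) {r C : ℝ} (hr : r ∈ Ioo (0 : ℝ) 1)
    (hC : ∀ z : 𝔻, ‖(z : ℂ)‖ = r → ‖f z‖ ≤ C) (n : ℕ) : ‖taylorCoeff n f‖ ≤ C / r ^ n := by
  have h := norm_iteratedDeriv_le_of_forall_norm_eq f.differentiableOn hr
    (fun z hz => (extendZero_coe f z).symm ▸ hC z hz) n
  rw [taylorCoeff_apply, norm_div, Complex.norm_natCast, div_le_iff₀' (by positivity)]
  exact h.trans_eq (mul_div_assoc _ _ _)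

theorem norm_taylorCoeff_succ_le (f : HolDisc) {r C : ℝ} (hr : r ∈ Ioo (0 : ℝ) 1)
    (hC : ∀ z : 𝔻, ‖(z : ℂ)‖ = r → ‖f.derivAt z‖ ≤ C) (n : ℕ) :
    ‖taylorCoeff (n + 1) f‖ ≤ C / ((n + 1) * r ^ n) := by
  have h := norm_iteratedDeriv_le_of_forall_norm_eq (f.differentiableOn.deriv isOpen_ball) hr hC n
  rw [← iteratedDeriv_succ'] at h
  rw [taylorCoeff_apply, norm_div, Complex.norm_natCast, div_le_iff₀' (by positivity)]
  refine h.trans_eq ?_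
  have := (pow_pos hr.1 n).ne'
  push_cast [Nat.factorial_succ]
  field_simp

end HolDisc

theorem one_third_le_div_succ_pow (n : ℕ) : (1 / 3 : ℝ) ≤ (n / (n + 1)) ^ n := by
  rcases eq_or_ne n 0 with rfl | hn
  · norm_num
  have hexp : (1 + (n : ℝ)⁻¹) ^ n ≤ 3 := by
    calc (1 + (n : ℝ)⁻¹) ^ n ≤ Real.exp (n : ℝ)⁻¹ ^ n := by
          gcongr
          rw [add_comm]
          exact Real.add_one_le_exp _
      _ = Real.exp 1 := by rw [← Real.exp_nat_mul, mul_inv_cancel₀ (Nat.cast_ne_zero.2 hn)]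
      _ ≤ 3 := Real.exp_one_lt_three.le
  have heq : (n / (n + 1) : ℝ) = (1 + (n : ℝ)⁻¹)⁻¹ := by field_simp
  rw [heq, inv_pow, one_div]
  exact inv_anti₀ (by positivity) hexp

/-- The radius of the circle on which Cauchy's estimate is applied to the `n`-th coefficient:
`1 - r² = 1 / (n + 1)`, while `rⁿ` stays bounded below. -/
noncomputable def cauchyRadius (n : ℕ) : ℝ := √(n / (n + 1))

theorem cauchyRadius_sq (n : ℕ) : cauchyRadius n ^ 2 = n / (n + 1) :=
  Real.sq_sqrt (by positivity)

theorem cauchyRadius_mem_Ioo {n : ℕ} (hn : n ≠ 0) : cauchyRadius n ∈ Ioo (0 : ℝ) 1 := by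
  refine ⟨Real.sqrt_pos.2 (by positivity), (Real.sqrt_lt' one_pos).2 ?_⟩
  rw [one_pow, div_lt_one (by positivity)]
  exact lt_add_one _

theorem one_third_le_cauchyRadius_pow {n : ℕ} (hn : n ≠ 0) : 1 / 3 ≤ cauchyRadius n ^ n := by
  obtain ⟨h0, h1⟩ := cauchyRadius_mem_Ioo hn
  calc (1 / 3 : ℝ) ≤ (cauchyRadius n ^ 2) ^ n := by
        rw [cauchyRadius_sq]
        exact one_third_le_div_succ_pow n
    _ ≤ cauchyRadius n ^ n := by
        gcongr
        exact pow_le_of_le_one h0.le h1.le two_ne_zero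

theorem normA1_kernel_le_two_mul_log {n : ℕ} (hn : n ≠ 0) {z : 𝔻}
    (hz : ‖(z : ℂ)‖ = cauchyRadius n) : normA1 (kernel z) ≤ 2 * Real.log (n + 1) := by
  have h := norm_sq_mul_normA1_kernel z
  have hr : 1 - (n / (n + 1) : ℝ) = (n + 1 : ℝ)⁻¹ := by field_simp; ring
  have hhalf : (1 / 2 : ℝ) ≤ n / (n + 1) := by
    have : (1 : ℝ) ≤ n := by exact_mod_cast Nat.one_le_iff_ne_zero.2 hn
    rw [div_le_div_iff₀ two_pos (by positivity)]
    linarith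
  rw [hz, cauchyRadius_sq, hr, Real.log_inv, neg_neg] at h
  nlinarith [normA1_kernel_pos z]

theorem norm_taylorCoeff_le_norm_mul_log (f : X) {n : ℕ} (hn : n ≠ 0) :
    ‖HolDisc.taylorCoeff n f.1‖ ≤ 6 * ‖f‖ * Real.log (n + 1) := by
  have hlog : 0 ≤ Real.log (n + 1) := Real.log_nonneg (by simp)
  have hbound (z : 𝔻) (hz : ‖(z : ℂ)‖ = cauchyRadius n) :
      ‖f.1 z‖ ≤ ‖f‖ * (2 * Real.log (n + 1)) :=
    (norm_le_norm_mul_normA1_kernel f z).trans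
      (mul_le_mul_of_nonneg_left (normA1_kernel_le_two_mul_log hn hz) (norm_nonneg f))
  calc ‖HolDisc.taylorCoeff n f.1‖ ≤ ‖f‖ * (2 * Real.log (n + 1)) / cauchyRadius n ^ n :=
        f.1.norm_taylorCoeff_le (cauchyRadius_mem_Ioo hn) hbound n
    _ ≤ ‖f‖ * (2 * Real.log (n + 1)) / (1 / 3) := by
        gcongr
        exact one_third_le_cauchyRadius_pow hn
    _ = 6 * ‖f‖ * Real.log (n + 1) := by ring

theorem isBigO_taylorCoeff_of_mem_Bloch {f : HolDisc} (hf : f ∈ Bloch) :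
    (fun n => HolDisc.taylorCoeff n f) =O[atTop] fun _ => (1 : ℝ) := by
  obtain ⟨A, hA⟩ := hf
  rw [mem_upperBounds, forall_mem_range] at hA
  have hA0 : 0 ≤ A := (mul_nonneg (by simp) (norm_nonneg (f.derivAt 0))).trans (hA 0)
  rw [← map_add_atTop_eq_nat 1, isBigO_map]
  refine .of_bound (3 * A) ((eventually_ne_atTop 0).mono fun n hn => ?_)
  have hderiv (z : 𝔻) (hz : ‖(z : ℂ)‖ = cauchyRadius n) : ‖f.derivAt z‖ ≤ A * (n + 1) := by
    have h := hA z
    have hr : 1 - (n / (n + 1) : ℝ) = (n + 1 : ℝ)⁻¹ := by field_simp; ring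
    rwa [hz, cauchyRadius_sq, hr, inv_mul_le_iff₀ (by positivity), mul_comm] at h
  calc ‖HolDisc.taylorCoeff (n + 1) f‖ ≤ A * (n + 1) / ((n + 1) * cauchyRadius n ^ n) :=
        f.norm_taylorCoeff_succ_le (cauchyRadius_mem_Ioo hn) hderiv n
    _ = A / cauchyRadius n ^ n := by field_simp
    _ ≤ A / (1 / 3) := by
        gcongr
        exact one_third_le_cauchyRadius_pow hn
    _ = 3 * A * ‖(1 : ℝ)‖ := by rw [norm_one]; ring

theorem tendsto_log_natCast_add_one : Tendsto (fun n : ℕ => Real.log (n + 1)) atTop atTop :=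
  Real.tendsto_log_atTop.comp (tendsto_atTop_add_const_right _ _ tendsto_natCast_atTop_atTop)

theorem isLittleO_taylorCoeff_of_mem_closure {f : X}
    (hf : f ∈ closure {g : X | (g : HolDisc) ∈ Bloch}) :
    (fun n => HolDisc.taylorCoeff n f.1) =o[atTop] fun n : ℕ => Real.log (n + 1) := by
  refine .of_bound fun ε hε => ?_
  obtain ⟨g, hg, hfg⟩ := Metric.mem_closure_iff.1 hf (ε / 12) (by positivity)
  rw [dist_eq_norm] at hfg
  have hlog (n : ℕ) : ‖Real.log (n + 1)‖ = Real.log (n + 1) :=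
    Real.norm_of_nonneg (Real.log_nonneg (by simp))
  have hgo := (isBigO_taylorCoeff_of_mem_Bloch hg).trans_isLittleO
    ((isLittleO_one_left_iff ℝ).2 (tendsto_norm_atTop_atTop.comp tendsto_log_natCast_add_one))
  filter_upwards [hgo.bound (half_pos hε), eventually_ne_atTop 0] with n hgn hn
  rw [hlog] at hgn ⊢
  calc ‖HolDisc.taylorCoeff n f.1‖
      = ‖HolDisc.taylorCoeff n (f - g).1 + HolDisc.taylorCoeff n g.1‖ := by
        rw [← map_add, ← Submodule.coe_add, sub_add_cancel]
    _ ≤ 6 * (ε / 12) * Real.log (n + 1) + ε / 2 * Real.log (n + 1) := by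
        have hlog0 : 0 ≤ Real.log (n + 1) := hlog n ▸ norm_nonneg _
        refine norm_add_le_of_le ((norm_taylorCoeff_le_norm_mul_log _ hn).trans ?_) hgn
        gcongr
    _ = ε * Real.log (n + 1) := by ring

theorem log_lacunaryExponent_add_one_le (k : ℕ) :
    Real.log (lacunaryExponent k + 1) ≤ 4 * 2 ^ k := by
  have h1 : (1 : ℝ) ≤ 2 ^ 2 ^ (k + 1) := one_le_pow₀ one_le_two
  have hk : (1 : ℝ) ≤ 2 ^ k := one_le_pow₀ one_le_two
  calc Real.log (lacunaryExponent k + 1) ≤ Real.log (2 ^ (2 ^ (k + 1) + 2)) := by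
        refine Real.log_le_log (by positivity) ?_
        push_cast [lacunaryExponent]
        rw [pow_add _ (2 ^ (k + 1)) 2]
        linarith
    _ = (2 * 2 ^ k + 2) * Real.log 2 := by
        rw [Real.log_pow]
        push_cast
        ring
    _ ≤ (2 * 2 ^ k + 2) * 1 := by
        gcongr
        linarith [Real.log_two_lt_d9]
    _ ≤ 4 * 2 ^ k := by linarith

theorem not_isLittleO_taylorCoeff_lacunaryX :
    ¬ (fun n => HolDisc.taylorCoeff n lacunaryX.1) =o[atTop] fun n : ℕ => Real.log (n + 1) := by
  intro h
  have hcomp := h.comp_tendsto lacunaryExponent_strictMono.tendsto_atTop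
  have hcoeff (k : ℕ) : HolDisc.taylorCoeff (lacunaryExponent k) lacunaryX.1 = 2 ^ k :=
    (HolDisc.taylorCoeff_eq hasSum_lacunaryCoeff _).trans (lacunaryCoeff_lacunaryExponent k)
  simp only [Function.comp_def, hcoeff] at hcomp
  refine IsBigO.not_isLittleO (.of_bound 4 (.of_forall fun k => ?_)) (.of_forall fun k => ?_) hcomp
  · rw [Real.norm_of_nonneg (Real.log_nonneg (by simp)), norm_pow, Complex.norm_two]
    exact log_lacunaryExponent_add_one_le k
  · exact (Real.log_pos (by simp [lacunaryExponent])).ne'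

end BlochX

theorem theorem2p1 : ¬ Dense {f : BlochX.X | (f : BlochX.HolDisc) ∈ BlochX.Bloch} := fun hdense =>
  BlochX.not_isLittleO_taylorCoeff_lacunaryX
    (BlochX.isLittleO_taylorCoeff_of_mem_closure (hdense BlochX.lacunaryX))
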